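/- Let $X=(X_t)_{t\ge 0}$ be a real-valued Lévy process on a filtered probability space $(\Omega,\mathcal F,(\mathcal F_t)_{t\ge0},\mathbb Q)$: $X$ is adapted and càdlàg, $X_0=0$, and for $0\le s<t$ the increment $X_t-X_s$ is independent of $\mathcal F_s$ with a law that depends only on $t-s$. Let $h(y)=y\mathbf 1_{\{|y|<1\}}$, and let $(\mu,\sigma,\Pi)$ be the characteristic triplet of $X$, that is, $\mu\in\mathbb R$, $\sigma\ge 0$, $\Pi$ is a Lévy measure ($\Pi(\{0\})=0$ and $\int_{\mathbb R}(1\wedge y^2)\,\Pi(dy)<\infty$), and $E e^{iqX_t}=e^{t\psi(q)}$ for all $q\in\mathbb R$, $t\ge0$, where $$\psi(z)=i\mu z-\tfrac12\sigma^2z^2+\int_{\mathbb R}\bigl(e^{izy}-1-izh(y)\bigr)\,\Pi(dy)$$ for every $z\in\mathbb C$ for which the integral converges absolutely. Suppose that $\Pi(dy)=e^{\beta y}\,\Pi_0(dy)$, where $\beta\in\mathbb R$, $\beta\ne-\tfrac12$, and $\Pi_0$ is a symmetric positive measure on $\mathbb R$, i.e. $\Pi_0(dy)=\Pi_0(-dy)$.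 Then the integral defining $\psi(2\beta i)$ converges absolutely, the number $$\alpha:=\begin{cases}-\dfrac{\psi(2\beta i)}{2\beta}, & \beta\ne 0,\\[2mm] \mu, & \beta=0,\end{cases}$$ is real, and for every $S_0>0$, every $T\ge0$ and every nonnegative Borel function $f:\mathbb R\to\mathbb R$, with $S_t=S_0e^{X_t}$, $$E f(S_T)=E\left[\left(\frac{S_T}{S_0e^{\alpha T}}\right)^{-2\beta} f\left(\frac{S_0^2e^{2\alpha T}}{S_T}\right)\right],$$ as an equality in $[0,\infty]$ (both sides may be $+\infty$). -/

import Mathlib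

open MeasureTheory ProbabilityTheory Filter Topology
open scoped NNReal ENNReal

noncomputable section

namespace LevyMarket

/-- A real-valued Lévy process `X` on a stochastic basis `(Ω, m, ℱ, Q)`: adapted, starting at `0`,
with càdlàg paths, increments independent of the past, and the law of `X_t - X_s` depending only
on `t - s`. -/
structure IsLevyProcess {Ω : Type*} {m : MeasurableSpace Ω} (ℱ : Filtration ℝ≥0 m)
    (Q : Measure Ω) (X : ℝ≥0 → Ω → ℝ) : Prop where
  adapted : Adapted ℱ X
  start_zero : ∀ᵐ ω ∂Q, X 0 ω = 0
  cadlag : ∀ᵐ ω ∂Q, ∀ t : ℝ≥0,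
    ContinuousWithinAt (fun s => X s ω) (Set.Ici t) t ∧
      ∃ l : ℝ, Tendsto (fun s => X s ω) (𝓝[<] t) (𝓝 l)
  indep_past : ∀ s t : ℝ≥0, s < t →
    Indep (MeasurableSpace.comap (fun ω => X t ω - X s ω) inferInstance) (ℱ s) Q
  stationary : ∀ s s' h : ℝ≥0,
    IdentDistrib (fun ω => X (s + h) ω - X s ω) (fun ω => X (s' + h) ω - X s' ω) Q Q

/-- The truncation function `h(y) = y 1_{|y| < 1}`. -/
def trunc (y : ℝ) : ℝ := if |y| < 1 then y else 0

/-- A Lévy measure: a measure on `ℝ` without mass at `0` and with `∫ (1 ∧ y²) Π(dy) < ∞`. -/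
structure IsLevyMeasure (Pi : Measure ℝ) : Prop where
  zero_singleton : Pi {0} = 0
  lintegral_lt_top : ∫⁻ y, ENNReal.ofReal (min 1 (y ^ 2)) ∂Pi < ∞

/-- The integrand `e^{izy} - 1 - i z h(y)` of the Lévy–Khintchine formula. -/
def lkIntegrand (z : ℂ) (y : ℝ) : ℂ :=
  Complex.exp (Complex.I * z * y) - 1 - Complex.I * z * (trunc y : ℂ)

/-- The characteristic exponent
`ψ(z) = i a z - σ² z² / 2 + ∫ (e^{izy} - 1 - i z h(y)) Π(dy)` at a complex argument `z`.
It is meaningful at those `z` for which `lkIntegrand z` is `Π`-integrable. -/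
def charExponent (a σ : ℝ) (Pi : Measure ℝ) (z : ℂ) : ℂ :=
  Complex.I * a * z - (σ : ℂ) ^ 2 * z ^ 2 / 2 + ∫ y, lkIntegrand z y ∂Pi

/-- `X` has characteristic triplet `(a, σ, Π)` under `Q` (`σ ≥ 0` is the standard deviation of the
Gaussian part): `Π` is a Lévy measure and `E e^{iqX_t} = e^{tψ(q)}` for all real `q`, `t ≥ 0`. -/
structure HasTriplet {Ω : Type*} {m : MeasurableSpace Ω} (Q : Measure Ω) (X : ℝ≥0 → Ω → ℝ)
    (a σ : ℝ) (Pi : Measure ℝ) : Prop where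
  sigma_nonneg : 0 ≤ σ
  levyMeasure : IsLevyMeasure Pi
  charFun_eq : ∀ (t : ℝ≥0) (q : ℝ),
    ∫ ω, Complex.exp (Complex.I * q * (X t ω : ℂ)) ∂Q =
      Complex.exp ((t : ℝ) * charExponent a σ Pi q)

/-- A measure on `ℝ` is symmetric if `Π₀(dy) = Π₀(-dy)`. -/
def IsSymmetricMeasure (Pi₀ : Measure ℝ) : Prop := Pi₀.map (fun y => -y) = Pi₀

/-- The measure `e^{βy} Π₀(dy)`. -/
def expTilt (β : ℝ) (Pi₀ : Measure ℝ) : Measure ℝ :=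
  Pi₀.withDensity (fun y => ENNReal.ofReal (Real.exp (β * y)))

/-- The stock price `S_t = S₀ e^{X_t}`. -/
def stock {Ω : Type*} (S₀ : ℝ) (X : ℝ≥0 → Ω → ℝ) (t : ℝ≥0) (ω : Ω) : ℝ :=
  S₀ * Real.exp (X t ω)

end LevyMarket

end

namespace LevyMarket

/-! The claim concerns only the law of `X T`: after centring by `α T`, multiplying it by `e^{-βx}`
must give a symmetric measure. This property (`IsExpSymmetric`) passes to convolutions, because its
weight is multiplicative, and to weak limits (`of_tendsto`). The Gaussian with mean `bv` and
variance `v` has it, and compound Poisson laws inherit it from their jump measure, here a tilt of a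
symmetric one. By Lévy–Khintchine and Lévy continuity, the centred law is the weak limit of
convolutions of such laws as the cutoff of small jumps is removed (`isExpSymmetric_of_charFun`).

The drift left over is `α = μ - σ²β - H`, where `H` is the limit of the compensators. For `β ≠ 0`,
`H` is read off from `ψ(2βi)`, since `e^{-2βy} - 1` integrates to zero over symmetric sets away from
the origin (`exists_tendsto_integral_trunc`). -/

/-- `e^{-bx} ν(dx)` is a symmetric measure, stated without assuming it finite. -/
def IsExpSymmetric (b : ℝ) (ν : Measure ℝ) : Prop :=
  ∀ g : ℝ → ℝ≥0∞, Measurable g →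
    ∫⁻ x, g (-x) ∂ν = ∫⁻ x, ENNReal.ofReal (Real.exp (-2 * b * x)) * g x ∂ν

/-! ### Exponential symmetry and its closure properties -/

namespace IsExpSymmetric

variable {b : ℝ} {ν ρ : Measure ℝ}

theorem dirac_zero (b : ℝ) : IsExpSymmetric b (Measure.dirac 0) := by
  intro g hg
  rw [lintegral_dirac' _ (by fun_prop), lintegral_dirac' _ (by fun_prop)]
  simp

theorem smul (h : IsExpSymmetric b ν) (c : ℝ≥0∞) : IsExpSymmetric b (c • ν) := by
  intro g hg
  rw [lintegral_smul_measure, lintegral_smul_measure, h g hg]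

theorem sum {ν : ℕ → Measure ℝ} (h : ∀ n, IsExpSymmetric b (ν n)) :
    IsExpSymmetric b (Measure.sum ν) := by
  intro g hg
  simp_rw [lintegral_sum_measure, h _ g hg]

theorem conv [SFinite ν] [SFinite ρ] (hν : IsExpSymmetric b ν) (hρ : IsExpSymmetric b ρ) :
    IsExpSymmetric b (ν ∗ ρ) := by
  intro g hg
  rw [Measure.lintegral_conv (by fun_prop), Measure.lintegral_conv (by fun_prop)]
  have h1 : ∀ x : ℝ, ∫⁻ y, g (-(x + y)) ∂ρ
      = ∫⁻ y, ENNReal.ofReal (Real.exp (-2 * b * y)) * g (-x + y) ∂ρ := fun x ↦ by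
    rw [← hρ (fun y ↦ g (-x + y)) (by fun_prop)]
    simp [add_comm]
  simp_rw [h1]
  rw [hν (fun x ↦ ∫⁻ y, ENNReal.ofReal (Real.exp (-2 * b * y)) * g (x + y) ∂ρ)
    (Measurable.lintegral_prod_right' (f := fun p : ℝ × ℝ ↦
      ENNReal.ofReal (Real.exp (-2 * b * p.2)) * g (p.1 + p.2)) (by fun_prop))]
  refine lintegral_congr fun x ↦ ?_
  rw [← lintegral_const_mul _ (by fun_prop)]
  refine lintegral_congr fun y ↦ ?_
  rw [← mul_assoc, ← ENNReal.ofReal_mul (by positivity), ← Real.exp_add, mul_add]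

theorem restrict (h : IsExpSymmetric b ν) {s : Set ℝ} (hs : MeasurableSet s)
    (hneg : ∀ x, -x ∈ s ↔ x ∈ s) : IsExpSymmetric b (ν.restrict s) := by
  intro g hg
  rw [← lintegral_indicator hs, ← lintegral_indicator hs]
  have := h (s.indicator g) (hg.indicator hs)
  convert this using 3 with x x
  · by_cases hx : x ∈ s <;> simp [Set.indicator, hx, hneg]
  · by_cases hx : x ∈ s <;> simp [Set.indicator, hx]

/-- Test against `g = 1`. This identity supplies both the convergence of `ψ(2bi)` and its value. -/
theorem lintegral_exp (h : IsExpSymmetric b ν) :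
    ∫⁻ x, ENNReal.ofReal (Real.exp (-2 * b * x)) ∂ν = ν Set.univ := by
  simpa using (h 1 measurable_one).symm

theorem integrable_exp [IsFiniteMeasure ν] (h : IsExpSymmetric b ν) :
    Integrable (fun x ↦ Real.exp (-2 * b * x)) ν := by
  refine ⟨by fun_prop, ?_⟩
  rw [hasFiniteIntegral_iff_ofReal (ae_of_all _ fun _ ↦ by positivity), h.lintegral_exp]
  exact measure_lt_top _ _

theorem integral_exp (h : IsExpSymmetric b ν) :
    ∫ x, Real.exp (-2 * b * x) ∂ν = ν.real Set.univ := by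
  rw [integral_eq_lintegral_of_nonneg_ae (ae_of_all _ fun _ ↦ by positivity) (by fun_prop),
    h.lintegral_exp, Measure.real]

theorem integral_odd_eq_zero (h : IsExpSymmetric 0 ν) {g : ℝ → ℝ} (hg : Measurable g)
    (hodd : ∀ x, g (-x) = -g x) : ∫ x, g x ∂ν = 0 := by
  have hmap : ν.map Neg.neg = ν := by
    refine Measure.ext_of_lintegral _ fun f hf ↦ ?_
    rw [lintegral_map hf measurable_neg, h f hf]
    simp
  have h1 : ∫ x, g x ∂ν = ∫ x, g (-x) ∂ν := by
    conv_lhs => rw [← hmap]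
    rw [integral_map measurable_neg.aemeasurable hg.aestronglyMeasurable]
  simp_rw [hodd, integral_neg] at h1
  linarith

/-- Completing the square: `e^{-bx}` times the density is a multiple of the centred Gaussian density
exactly when the mean is `bv`. -/
theorem gaussianReal (b : ℝ) (v : ℝ≥0) :
    IsExpSymmetric b (ProbabilityTheory.gaussianReal (b * v) v) := by
  by_cases hv : v = 0
  · simpa [hv] using dirac_zero b
  intro g hg
  rw [gaussianReal_of_var_ne_zero _ hv,
    lintegral_withDensity_eq_lintegral_mul _ (by fun_prop) (by fun_prop),
    lintegral_withDensity_eq_lintegral_mul _ (by fun_prop) (by fun_prop),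
    ← lintegral_neg_eq_self]
  refine lintegral_congr fun x ↦ ?_
  simp only [Pi.mul_apply, neg_neg, ← mul_assoc]
  congr 1
  simp only [gaussianPDF, gaussianPDFReal]
  rw [← ENNReal.ofReal_mul (by positivity), mul_assoc _ (Real.exp _) (Real.exp _), ← Real.exp_add]
  congr 3
  have : (v : ℝ) ≠ 0 := by exact_mod_cast hv
  field_simp
  ring

/-- With the logistic weight `1 / (1 + e^{2bx})` exponential symmetry becomes symmetry. -/
theorem iff_logistic : IsExpSymmetric b ν ↔ ∀ g : ℝ → ℝ≥0∞, Measurable g →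
    ∫⁻ x, ENNReal.ofReal (1 + Real.exp (2 * b * x))⁻¹ * g (-x) ∂ν
      = ∫⁻ x, ENNReal.ofReal (1 + Real.exp (2 * b * x))⁻¹ * g x ∂ν := by
  have key : ∀ x : ℝ, (1 + Real.exp (2 * b * x))⁻¹
      = Real.exp (-2 * b * x) * (1 + Real.exp (2 * b * -x))⁻¹ := fun x ↦ by
    have h1 : Real.exp (2 * b * -x) = Real.exp (-2 * b * x) := by ring_nf
    have h2 : Real.exp (2 * b * x) = (Real.exp (-2 * b * x))⁻¹ := by
      rw [← Real.exp_neg]; ring_nf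
    rw [h1, h2]
    have := Real.exp_pos (-2 * b * x)
    field_simp
    ring
  constructor
  · intro h g hg
    have := h (fun x ↦ ENNReal.ofReal (1 + Real.exp (2 * b * -x))⁻¹ * g x) (by fun_prop)
    simp only [neg_neg] at this
    rw [this]
    refine lintegral_congr fun x ↦ ?_
    rw [← mul_assoc, ← ENNReal.ofReal_mul (by positivity), ← key]
  · intro h g hg
    have := h (fun x ↦ ENNReal.ofReal (1 + Real.exp (2 * b * -x)) * g x) (by fun_prop)
    simp only [neg_neg, ← mul_assoc, ← ENNReal.ofReal_mul' (add_nonneg zero_le_one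
      (Real.exp_nonneg _))] at this
    convert this using 3 with x x
    · rw [inv_mul_cancel₀ (by positivity)]; simp
    · rw [key, mul_assoc (Real.exp _), inv_mul_cancel₀ (by positivity), mul_one]

/-- Exponential symmetry is closed under weak convergence. -/
theorem of_tendsto {νs : ℕ → ProbabilityMeasure ℝ} {ν : ProbabilityMeasure ℝ}
    (hlim : Tendsto νs atTop (𝓝 ν)) (h : ∀ n, IsExpSymmetric b (νs n : Measure ℝ)) :
    IsExpSymmetric b (ν : Measure ℝ) := by
  rw [iff_logistic]
  set w : ℝ → ℝ≥0∞ := fun x ↦ ENNReal.ofReal (1 + Real.exp (2 * b * x))⁻¹ with hw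
  have hwm : Measurable w := by fun_prop
  have hw1 : ∀ x, w x ≤ 1 := fun x ↦ by
    rw [hw, ENNReal.ofReal_le_one]
    exact inv_le_one_of_one_le₀ (by linarith [Real.exp_pos (2 * b * x)])
  -- `V` is `w` as a bounded continuous function, admissible in weak convergence; the unbounded
  -- `e^{-2bx}` would not be.
  set V : BoundedContinuousFunction ℝ ℝ≥0 :=
    BoundedContinuousFunction.mkOfBound
      ⟨fun x ↦ (1 + Real.exp (2 * b * x)).toNNReal⁻¹, by
        refine Continuous.inv₀ (by fun_prop) fun x ↦ ?_
        simp only [ne_eq, Real.toNNReal_eq_zero, not_le]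
        positivity⟩ 1 (fun x y ↦ by
        have hb : ∀ x : ℝ, (((1 + Real.exp (2 * b * x)).toNNReal⁻¹ : ℝ≥0) : ℝ) ≤ 1 := fun x ↦ by
          rw [NNReal.coe_inv, Real.coe_toNNReal _ (by positivity)]
          exact inv_le_one_of_one_le₀ (by linarith [Real.exp_pos (2 * b * x)])
        rw [NNReal.dist_eq, abs_le]
        constructor
        · have := hb y; have := NNReal.coe_nonneg ((1 + Real.exp (2 * b * x)).toNNReal⁻¹)
          simp only [ContinuousMap.coe_mk]; linarith
        · have := hb x; have := NNReal.coe_nonneg ((1 + Real.exp (2 * b * y)).toNNReal⁻¹)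
          simp only [ContinuousMap.coe_mk]; linarith) with hV
  have hVw : ∀ x, (V x : ℝ≥0∞) = w x := fun x ↦ by
    simp only [hV, hw, BoundedContinuousFunction.mkOfBound_coe, ContinuousMap.coe_mk]
    rw [ENNReal.ofReal, Real.toNNReal_inv]
  have : IsFiniteMeasure ((ν : Measure ℝ).withDensity w) :=
    isFiniteMeasure_withDensity ((lintegral_mono hw1).trans_lt (by simp)).ne
  have hsymm : ((ν : Measure ℝ).withDensity w).map Neg.neg = (ν : Measure ℝ).withDensity w := by
    refine ext_of_forall_lintegral_eq_of_IsFiniteMeasure fun f ↦ ?_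
    have hfm : Measurable fun x ↦ (f x : ℝ≥0∞) := f.continuous.measurable.coe_nnreal_ennreal
    have hfm' : Measurable fun x ↦ (f (-x) : ℝ≥0∞) := hfm.comp measurable_neg
    rw [lintegral_map hfm measurable_neg, lintegral_withDensity_eq_lintegral_mul _ hwm hfm',
      lintegral_withDensity_eq_lintegral_mul _ hwm hfm]
    rw [ProbabilityMeasure.tendsto_iff_forall_lintegral_tendsto] at hlim
    -- Both sides are limits of one sequence, since each `νs n` is already symmetric for the weight
    -- `w`.
    refine tendsto_nhds_unique (f := fun n ↦ ∫⁻ x, w x * f (-x) ∂(νs n : Measure ℝ))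
      ?_ ?_ (l := atTop)
    · have := hlim (V * f.compContinuous ⟨Neg.neg, continuous_neg⟩)
      simpa [hVw] using this
    · have := hlim (V * f)
      simp only [BoundedContinuousFunction.coe_mul, Pi.mul_apply, ENNReal.coe_mul, hVw] at this
      refine this.congr fun n ↦ ?_
      exact (iff_logistic.1 (h n) _ hfm).symm
  intro g hg
  have hg' : Measurable fun x ↦ g (-x) := hg.comp measurable_neg
  have e1 := lintegral_withDensity_eq_lintegral_mul (ν : Measure ℝ) hwm hg
  rw [← hsymm, lintegral_map hg measurable_neg,
    lintegral_withDensity_eq_lintegral_mul _ hwm hg'] at e1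
  simpa using e1

end IsExpSymmetric

/-! ### Compound Poisson laws -/

/-- The `n`-fold convolution of a measure with itself. -/
noncomputable def convPow (ν : Measure ℝ) : ℕ → Measure ℝ
  | 0 => Measure.dirac 0
  | n + 1 => convPow ν n ∗ ν

instance (ν : Measure ℝ) [IsFiniteMeasure ν] (n : ℕ) : IsFiniteMeasure (convPow ν n) := by
  induction n with
  | zero => exact inferInstanceAs (IsFiniteMeasure (Measure.dirac 0))
  | succ n ih => exact inferInstanceAs (IsFiniteMeasure (convPow ν n ∗ ν))

theorem charFun_convPow (ν : Measure ℝ) [IsFiniteMeasure ν] (n : ℕ) (t : ℝ) :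
    charFun (convPow ν n) t = charFun ν t ^ n := by
  induction n with
  | zero => simp [convPow]
  | succ n ih => rw [convPow, charFun_conv, ih, pow_succ]

theorem IsExpSymmetric.convPow {b : ℝ} {ν : Measure ℝ} [IsFiniteMeasure ν]
    (h : IsExpSymmetric b ν) (n : ℕ) : IsExpSymmetric b (convPow ν n) := by
  induction n with
  | zero => exact IsExpSymmetric.dirac_zero b
  | succ n ih => exact ih.conv h

theorem convPow_univ (ν : Measure ℝ) [IsFiniteMeasure ν] (n : ℕ) :
    convPow ν n Set.univ = ENNReal.ofReal (ν.real Set.univ ^ n) := by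
  have h := charFun_convPow ν n 0
  rw [charFun_zero, charFun_zero] at h
  rw [← ENNReal.ofReal_toReal (measure_ne_top (LevyMarket.convPow ν n) Set.univ)]
  congr 1
  exact_mod_cast h

/-- The compound Poisson law with finite jump measure `ν`. -/
noncomputable def compoundPoisson (ν : Measure ℝ) : Measure ℝ :=
  Measure.sum fun n ↦
    ENNReal.ofReal (Real.exp (-ν.real Set.univ) / n.factorial) • convPow ν n

instance (ν : Measure ℝ) [IsFiniteMeasure ν] : IsProbabilityMeasure (compoundPoisson ν) := by
  constructor
  rw [compoundPoisson, Measure.sum_apply _ MeasurableSet.univ]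
  simp only [Measure.smul_apply, smul_eq_mul, convPow_univ]
  have hs : HasSum (fun n : ℕ ↦ Real.exp (-ν.real Set.univ) / n.factorial * ν.real Set.univ ^ n)
      1 := by
    have := (NormedSpace.expSeries_div_hasSum_exp (ν.real Set.univ)).mul_left
      (Real.exp (-ν.real Set.univ))
    rw [← Real.exp_eq_exp_ℝ, ← Real.exp_add, neg_add_cancel, Real.exp_zero] at this
    refine (funext fun n ↦ ?_ : _ = fun n : ℕ ↦ _) ▸ this
    ring
  simp_rw [← ENNReal.ofReal_mul (div_nonneg (Real.exp_nonneg _) (Nat.cast_nonneg _))]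
  rw [← ENNReal.ofReal_tsum_of_nonneg (fun n ↦ by positivity) hs.summable, hs.tsum_eq,
    ENNReal.ofReal_one]

theorem charFun_compoundPoisson (ν : Measure ℝ) [IsFiniteMeasure ν] (t : ℝ) :
    charFun (compoundPoisson ν) t = Complex.exp (charFun ν t - ν.real Set.univ) := by
  have hint : Integrable (fun x : ℝ ↦ Complex.exp (t * x * Complex.I)) (compoundPoisson ν) := by
    refine (integrable_const (1 : ℝ)).mono (by fun_prop) (ae_of_all _ fun x ↦ ?_)
    rw [← Complex.ofReal_mul, Complex.norm_exp_ofReal_mul_I]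
    simp
  have hs := (NormedSpace.expSeries_div_hasSum_exp (charFun ν t)).mul_left
      ((Real.exp (-ν.real Set.univ) : ℝ) : ℂ)
  rw [← Complex.exp_eq_exp_ℂ, Complex.ofReal_exp, ← Complex.exp_add] at hs
  rw [charFun_apply_real]
  rw [sub_eq_neg_add, ← Complex.ofReal_neg]
  refine (hasSum_integral_measure hint).unique ((funext fun n ↦ ?_ : _ = fun n : ℕ ↦ _) ▸ hs)
  rw [integral_smul_measure, ← charFun_apply_real, charFun_convPow,
    ENNReal.toReal_ofReal (by positivity), Complex.real_smul]
  push_cast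
  ring

theorem IsExpSymmetric.compoundPoisson {b : ℝ} {ν : Measure ℝ} [IsFiniteMeasure ν]
    (h : IsExpSymmetric b ν) : IsExpSymmetric b (compoundPoisson ν) :=
  IsExpSymmetric.sum fun n ↦ (h.convPow n).smul _

/-! ### Tilted Lévy measures and the Lévy–Khintchine integral -/

theorem IsSymmetricMeasure.isExpSymmetric_expTilt {Pi₀ : Measure ℝ} (h : IsSymmetricMeasure Pi₀)
    (b : ℝ) : IsExpSymmetric b (expTilt b Pi₀) := by
  intro g hg
  rw [expTilt, lintegral_withDensity_eq_lintegral_mul _ (by fun_prop) (by fun_prop),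
    lintegral_withDensity_eq_lintegral_mul _ (by fun_prop) (by fun_prop)]
  conv_lhs => rw [← h]
  rw [lintegral_map (by fun_prop) (by fun_prop)]
  refine lintegral_congr fun x ↦ ?_
  simp only [Pi.mul_apply, neg_neg, ← mul_assoc]
  rw [← ENNReal.ofReal_mul (by positivity), ← Real.exp_add]
  ring_nf

@[fun_prop]
theorem measurable_trunc : Measurable trunc :=
  Measurable.ite (measurableSet_lt (by fun_prop) (by fun_prop)) measurable_id measurable_const

theorem abs_trunc_le_one (y : ℝ) : |trunc y| ≤ 1 := by
  unfold trunc
  split_ifs with h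
  · exact h.le
  · simp

theorem trunc_neg (y : ℝ) : trunc (-y) = -trunc y := by
  unfold trunc
  rw [abs_neg]
  split_ifs <;> simp

@[fun_prop]
theorem measurable_lkIntegrand (z : ℂ) : Measurable (lkIntegrand z) := by
  unfold lkIntegrand
  fun_prop

/-- Second-order Taylor bound for small jumps; for large ones only the exponential can be unbounded.
-/
theorem norm_lkIntegrand_le (z : ℂ) (y : ℝ) :
    ‖lkIntegrand z y‖ ≤ (‖z‖ ^ 2 * Real.exp ‖z‖ + 1) * min 1 (y ^ 2)
      + {y : ℝ | 1 ≤ |y|}.indicator (fun y ↦ ‖Complex.exp (Complex.I * z * y)‖) y := by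
  by_cases h : |y| < 1
  · have h' : y ∉ {y : ℝ | 1 ≤ |y|} := by simpa using h
    have hy2 : y ^ 2 ≤ 1 := by rw [sq_le_one_iff_abs_le_one]; exact h.le
    rw [Set.indicator_of_notMem h', add_zero, min_eq_right hy2, lkIntegrand, trunc, if_pos h]
    have h1 := Complex.norm_exp_sub_sum_le_norm_mul_exp (Complex.I * z * y) 2
    simp only [Finset.sum_range_succ, Finset.sum_range_zero, pow_zero, pow_one, Nat.factorial,
      norm_mul, Complex.norm_I, one_mul, Complex.norm_real, Real.norm_eq_abs, zero_add,
      Nat.cast_one, div_one, mul_one] at h1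
    rw [← sub_sub] at h1
    refine h1.trans ?_
    rw [mul_pow, sq_abs]
    have h2 : Real.exp (‖z‖ * |y|) ≤ Real.exp ‖z‖ :=
      Real.exp_le_exp.2 (mul_le_of_le_one_right (norm_nonneg _) h.le)
    calc ‖z‖ ^ 2 * y ^ 2 * Real.exp (‖z‖ * |y|) ≤ ‖z‖ ^ 2 * y ^ 2 * Real.exp ‖z‖ := by gcongr
      _ ≤ (‖z‖ ^ 2 * Real.exp ‖z‖ + 1) * y ^ 2 := by nlinarith [sq_nonneg y]
  · have h' : y ∈ {y : ℝ | 1 ≤ |y|} := by simpa using h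
    have hy2 : 1 ≤ y ^ 2 := by
      rw [one_le_sq_iff_one_le_abs]
      exact not_lt.1 h
    rw [Set.indicator_of_mem h', min_eq_left hy2, lkIntegrand, trunc, if_neg h]
    simp only [Complex.ofReal_zero, mul_zero, sub_zero, mul_one]
    have h1 := norm_sub_le (Complex.exp (Complex.I * z * y)) 1
    rw [norm_one] at h1
    have : 0 ≤ ‖z‖ ^ 2 * Real.exp ‖z‖ := by positivity
    linarith

/-- The complement of the ball of radius `1 / (n + 1)`. -/
def awayFromZero (n : ℕ) : Set ℝ := {y | 1 / ((n : ℝ) + 1) ≤ |y|}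

theorem measurableSet_awayFromZero (n : ℕ) : MeasurableSet (awayFromZero n) :=
  measurableSet_le (by fun_prop) (by fun_prop)

theorem neg_mem_awayFromZero (n : ℕ) (x : ℝ) : -x ∈ awayFromZero n ↔ x ∈ awayFromZero n := by
  simp [awayFromZero]

theorem awayFromZero_zero : awayFromZero 0 = {y : ℝ | 1 ≤ |y|} := by simp [awayFromZero]

theorem IsExpSymmetric.restrict_awayFromZero {b : ℝ} {Pi : Measure ℝ} (h : IsExpSymmetric b Pi)
    (n : ℕ) : IsExpSymmetric b (Pi.restrict (awayFromZero n)) :=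
  h.restrict (measurableSet_awayFromZero n) (neg_mem_awayFromZero n)

namespace IsLevyMeasure

variable {Pi : Measure ℝ}

theorem integrable_min (h : IsLevyMeasure Pi) : Integrable (fun y : ℝ ↦ min 1 (y ^ 2)) Pi := by
  refine ⟨by fun_prop, ?_⟩
  rw [hasFiniteIntegral_iff_ofReal (ae_of_all _ fun y ↦ le_min zero_le_one (sq_nonneg y))]
  exact h.lintegral_lt_top

theorem isFiniteMeasure_restrict (h : IsLevyMeasure Pi) (n : ℕ) :
    IsFiniteMeasure (Pi.restrict (awayFromZero n)) := by
  refine MeasureTheory.isFiniteMeasure_restrict.2 ?_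
  have hpos : 0 < (1 / ((n : ℝ) + 1)) ^ 2 := by positivity
  refine ((measure_mono fun (y : ℝ) hy ↦ ?_).trans_lt
    (h.integrable_min.measure_ge_lt_top hpos)).ne
  change _ ≤ min 1 (y ^ 2)
  refine le_min ?_ ?_
  · refine pow_le_one₀ (by positivity) ?_
    rw [div_le_one (by positivity)]
    linarith [Nat.cast_nonneg (α := ℝ) n]
  · rw [← sq_abs y]
    exact pow_le_pow_left₀ (by positivity) hy 2

theorem integrable_lkIntegrand (h : IsLevyMeasure Pi) (z : ℂ)
    (hz : Integrable (fun y : ℝ ↦ Complex.exp (Complex.I * z * y))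
      (Pi.restrict (awayFromZero 0))) : Integrable (lkIntegrand z) Pi := by
  have h1 := (integrable_indicator_iff (measurableSet_awayFromZero 0)).2 hz.norm
  rw [awayFromZero_zero] at h1
  exact ((h.integrable_min.const_mul _).add h1).mono' (by fun_prop)
    (ae_of_all _ (norm_lkIntegrand_le z))

theorem integrable_lkIntegrand_real (h : IsLevyMeasure Pi) (q : ℝ) :
    Integrable (lkIntegrand q) Pi := by
  refine h.integrable_lkIntegrand q ?_
  have := h.isFiniteMeasure_restrict 0
  refine (integrable_const (1 : ℝ)).mono (by fun_prop) (ae_of_all _ fun y ↦ ?_)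
  rw [mul_assoc, ← Complex.ofReal_mul, Complex.norm_exp_I_mul_ofReal]
  simp

/-- At `z = 2bi` the exponential is `e^{-2by}`, whose integral over `|y| ≥ 1` equals the finite mass
of that set. -/
theorem integrable_lkIntegrand_two_mul_I (h : IsLevyMeasure Pi) {b : ℝ}
    (hb : IsExpSymmetric b Pi) : Integrable (lkIntegrand (2 * b * Complex.I)) Pi := by
  refine h.integrable_lkIntegrand _ ?_
  have := h.isFiniteMeasure_restrict 0
  refine (hb.restrict_awayFromZero 0).integrable_exp.ofReal.congr (ae_of_all _ fun y ↦ ?_)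
  simp only [Complex.coe_algebraMap, Complex.ofReal_exp]
  congr 1
  push_cast
  linear_combination (-2 * b * y : ℂ) * Complex.I_sq

theorem integrable_trunc (h : IsLevyMeasure Pi) (n : ℕ) :
    Integrable trunc (Pi.restrict (awayFromZero n)) := by
  have := h.isFiniteMeasure_restrict n
  refine (integrable_const (1 : ℝ)).mono (by fun_prop) (ae_of_all _ fun y ↦ ?_)
  simpa using abs_trunc_le_one y

/-- Cutting off the small jumps is harmless in the limit. -/
theorem tendsto_integral_lkIntegrand {z : ℂ} (hz : Integrable (lkIntegrand z) Pi) :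
    Tendsto (fun n ↦ ∫ y in awayFromZero n, lkIntegrand z y ∂Pi) atTop
      (𝓝 (∫ y, lkIntegrand z y ∂Pi)) := by
  simp_rw [← integral_indicator (measurableSet_awayFromZero _)]
  refine tendsto_integral_of_dominated_convergence (fun y ↦ ‖lkIntegrand z y‖)
    (fun n ↦ ((measurable_lkIntegrand z).indicator
      (measurableSet_awayFromZero n)).aestronglyMeasurable) hz.norm
    (fun n ↦ ae_of_all _ fun y ↦ norm_indicator_le_norm_self _ _) (ae_of_all _ fun y ↦ ?_)
  -- The origin lies in no cutoff set, but the integrand vanishes there.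
  by_cases hy : y = 0
  · have h0 : lkIntegrand z y = 0 := by simp [lkIntegrand, trunc, hy]
    have : ∀ n, (awayFromZero n).indicator (lkIntegrand z) y = 0 := fun n ↦ by
      simp [Set.indicator, h0]
    simp [this, h0]
  · have hlim := (tendsto_one_div_add_atTop_nhds_zero_nat (𝕜 := ℝ)).eventually
      (gt_mem_nhds (abs_pos.2 hy))
    refine tendsto_const_nhds.congr' ?_
    filter_upwards [hlim] with n hn
    rw [Set.indicator_of_mem (show y ∈ awayFromZero n from hn.le)]

/-- Without small jumps the compensator is integrable on its own, so the compound Poisson exponent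
is the Lévy–Khintchine integral plus a drift. -/
theorem charFun_sub_measureReal (h : IsLevyMeasure Pi) (n : ℕ) (q : ℝ) :
    charFun (Pi.restrict (awayFromZero n)) q - (Pi.restrict (awayFromZero n)).real Set.univ
      = ∫ y in awayFromZero n, lkIntegrand q y ∂Pi
        + Complex.I * q * (∫ y in awayFromZero n, trunc y ∂Pi : ℝ) := by
  have := h.isFiniteMeasure_restrict n
  have e : ∫ y in awayFromZero n, Complex.exp (Complex.I * q * y) - 1 ∂Pi
      = ∫ y in awayFromZero n, lkIntegrand q y + Complex.I * q * (trunc y : ℂ) ∂Pi := by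
    congr with y
    simp [lkIntegrand]
  have hexp : Integrable (fun y : ℝ ↦ Complex.exp (Complex.I * q * y))
      (Pi.restrict (awayFromZero n)) := by
    refine (integrable_const (1 : ℝ)).mono (by fun_prop) (ae_of_all _ fun y ↦ ?_)
    rw [mul_assoc, ← Complex.ofReal_mul, Complex.norm_exp_I_mul_ofReal]
    simp
  have htr : Integrable (fun y ↦ Complex.I * q * (trunc y : ℂ)) (Pi.restrict (awayFromZero n)) :=
    (h.integrable_trunc n).ofReal.const_mul _
  rw [integral_add (h.integrable_lkIntegrand_real q).integrableOn htr, integral_const_mul,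
    integral_complex_ofReal,
    integral_sub hexp (integrable_const _)] at e
  rw [← e, charFun_apply_real, integral_const]
  congr 1
  · congr with y
    ring_nf
  · simp

/-- The compensator of the truncated jump measures converges, and its limit is determined by
the Lévy–Khintchine integral at `2bi`. -/
theorem exists_tendsto_integral_trunc (h : IsLevyMeasure Pi) {b : ℝ} (hb : IsExpSymmetric b Pi) :
    ∃ H : ℝ, Tendsto (fun n ↦ ∫ y in awayFromZero n, trunc y ∂Pi) atTop (𝓝 H) ∧
      ∫ y, lkIntegrand (2 * b * Complex.I) y ∂Pi = 2 * b * H ∧ (b = 0 → H = 0) := by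
  have hn : ∀ n, ∫ y in awayFromZero n, lkIntegrand (2 * b * Complex.I) y ∂Pi
      = ((2 * b * ∫ y in awayFromZero n, trunc y ∂Pi : ℝ) : ℂ) := fun n ↦ by
    have := h.isFiniteMeasure_restrict n
    have hs := hb.restrict_awayFromZero n
    have e : ∀ y : ℝ, lkIntegrand (2 * b * Complex.I) y
        = ((Real.exp (-2 * b * y) - 1 + 2 * b * trunc y : ℝ) : ℂ) := fun y ↦ by
      rw [lkIntegrand]
      have : Complex.I * (2 * b * Complex.I) = -2 * b := by
        linear_combination (2 * b : ℂ) * Complex.I_sq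
      rw [this]
      push_cast
      ring
    have hexp : Integrable (fun y ↦ Real.exp (-2 * b * y) - 1) (Pi.restrict (awayFromZero n)) :=
      hs.integrable_exp.sub (integrable_const _)
    simp_rw [e]
    rw [integral_complex_ofReal, integral_add hexp
      ((h.integrable_trunc n).const_mul _), integral_sub hs.integrable_exp (integrable_const _),
      hs.integral_exp, integral_const, integral_const_mul]
    simp
  have hlim := tendsto_integral_lkIntegrand (h.integrable_lkIntegrand_two_mul_I hb)
  simp_rw [hn] at hlim
  -- For `b = 0` the limit of `2b` times the compensators says nothing; oddness of `trunc` under a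
  -- symmetric measure gives `H = 0` instead.
  by_cases hb0 : b = 0
  · subst hb0
    have h0 : ∀ n, ∫ y in awayFromZero n, trunc y ∂Pi = 0 := fun n ↦
      (hb.restrict_awayFromZero n).integral_odd_eq_zero measurable_trunc trunc_neg
    refine ⟨0, by simp [h0], ?_, fun _ ↦ rfl⟩
    rw [tendsto_nhds_unique hlim (by simp : Tendsto _ atTop (𝓝 (0 : ℂ)))]
    simp
  · have hre := (Complex.continuous_re.tendsto _).comp hlim
    have him := (Complex.continuous_im.tendsto _).comp hlim
    simp only [Function.comp_def, Complex.ofReal_re, Complex.ofReal_im] at hre him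
    have him0 := tendsto_nhds_unique him tendsto_const_nhds
    refine ⟨(∫ y, lkIntegrand (2 * b * Complex.I) y ∂Pi).re / (2 * b), ?_, ?_, fun h ↦ absurd h hb0⟩
    · refine (hre.div_const (2 * b)).congr fun n ↦ ?_
      field_simp
    · have hJ : ∫ y, lkIntegrand (2 * b * Complex.I) y ∂Pi
          = ((∫ y, lkIntegrand (2 * b * Complex.I) y ∂Pi).re : ℂ) :=
        Complex.ext rfl (by simpa using him0)
      have hb0' : (b : ℂ) ≠ 0 := by exact_mod_cast hb0
      conv_lhs => rw [hJ]
      push_cast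
      field_simp

end IsLevyMeasure

/-! ### Exponential symmetry of the centred law, and the theorem -/

/-- A law whose Lévy–Khintchine exponent has a tilted symmetric jump measure, and drift matching
the tilt, is exponentially symmetric. -/
theorem isExpSymmetric_of_charFun {Pi : Measure ℝ} (h : IsLevyMeasure Pi) {b : ℝ}
    (hb : IsExpSymmetric b Pi) {H : ℝ}
    (hH : Tendsto (fun n ↦ ∫ y in awayFromZero n, trunc y ∂Pi) atTop (𝓝 H)) (σ : ℝ) (T : ℝ≥0)
    {ν : Measure ℝ} [IsProbabilityMeasure ν]
    (hν : ∀ q : ℝ, charFun ν q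
      = Complex.exp ((T : ℝ) * charExponent (b * σ ^ 2 + H) σ Pi q)) : IsExpSymmetric b ν := by
  have hfin := h.isFiniteMeasure_restrict
  set v : ℝ≥0 := (σ ^ 2).toNNReal * T with hv
  have hvr : (v : ℝ) = σ ^ 2 * T := by simp [hv, Real.coe_toNNReal _ (sq_nonneg σ)]
  let P : ℕ → Measure ℝ := fun n ↦ (T : ℝ≥0∞) • Pi.restrict (awayFromZero n)
  have hP : ∀ n, IsFiniteMeasure (P n) := fun n ↦
    Measure.smul_finite _ ENNReal.coe_ne_top
  have hPb : ∀ n, IsExpSymmetric b (P n) := fun n ↦ (hb.restrict_awayFromZero n).smul _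
  -- The Gaussian mean `bv = bσ²T` and the uncompensated jumps, contributing `HT` in the limit,
  -- match the drift `bσ² + H`.
  let νs : ℕ → ProbabilityMeasure ℝ := fun n ↦
    ⟨compoundPoisson (P n) ∗ gaussianReal (b * v) v, inferInstance⟩
  let ν' : ProbabilityMeasure ℝ := ⟨ν, inferInstance⟩
  refine IsExpSymmetric.of_tendsto (νs := νs) (ν := ν') ?_ fun n ↦
    (hPb n).compoundPoisson.conv (IsExpSymmetric.gaussianReal b v)
  rw [ProbabilityMeasure.tendsto_iff_tendsto_charFun]
  intro q
  have hcP : ∀ n, charFun (P n) q - (P n).real Set.univ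
      = (T : ℝ) * (charFun (Pi.restrict (awayFromZero n)) q
        - (Pi.restrict (awayFromZero n)).real Set.univ) := fun n ↦ by
    simp only [P]
    rw [charFun_apply_real, integral_smul_measure, ← charFun_apply_real, measureReal_def,
      Measure.smul_apply, smul_eq_mul, ENNReal.toReal_mul, ← measureReal_def,
      ENNReal.coe_toReal, Complex.real_smul]
    push_cast
    ring
  have hlim : Tendsto (fun n ↦ Complex.exp ((T : ℝ) * (∫ y in awayFromZero n, lkIntegrand q y ∂Pi
        + Complex.I * q * (∫ y in awayFromZero n, trunc y ∂Pi : ℝ)))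
        * Complex.exp (q * (b * v : ℝ) * Complex.I - v * q ^ 2 / 2)) atTop
      (𝓝 (Complex.exp ((T : ℝ) * (∫ y, lkIntegrand q y ∂Pi + Complex.I * q * (H : ℝ)))
        * Complex.exp (q * (b * v : ℝ) * Complex.I - v * q ^ 2 / 2))) := by
    refine Tendsto.mul_const _ ((Complex.continuous_exp.tendsto _).comp
      (Tendsto.const_mul _ (Tendsto.add ?_ (Tendsto.const_mul _ ?_))))
    · exact IsLevyMeasure.tendsto_integral_lkIntegrand (h.integrable_lkIntegrand_real q)
    · exact (Complex.continuous_ofReal.tendsto _).comp hH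
  convert hlim using 2 with n
  · simp only [νs, ProbabilityMeasure.coe_mk]
    rw [charFun_conv, charFun_compoundPoisson, charFun_gaussianReal, hcP,
      h.charFun_sub_measureReal]
  · rw [show (ν' : Measure ℝ) = ν from rfl, hν, ← Complex.exp_add, charExponent]
    have hvc : ((v : ℝ) : ℂ) = σ ^ 2 * (T : ℝ) := by rw [hvr]; push_cast; rfl
    congr 2
    push_cast at hvc ⊢
    rw [hvc]
    ring

/-- The centred law of a Lévy process whose jump measure is a tilted symmetric measure is
exponentially symmetric. -/
theorem HasTriplet.isExpSymmetric_map {Ω : Type*} {m : MeasurableSpace Ω} {Q : Measure Ω}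
    [IsProbabilityMeasure Q] {X : ℝ≥0 → Ω → ℝ} {μ σ b H : ℝ} {Pi : Measure ℝ}
    (hX : HasTriplet Q X μ σ Pi) (hb : IsExpSymmetric b Pi)
    (hH : Tendsto (fun n ↦ ∫ y in awayFromZero n, trunc y ∂Pi) atTop (𝓝 H)) (T : ℝ≥0)
    (hm : Measurable (X T)) :
    IsExpSymmetric b (Q.map fun ω ↦ X T ω - (μ - σ ^ 2 * b - H) * T) := by
  have hm' : Measurable fun ω ↦ X T ω - (μ - σ ^ 2 * b - H) * T := by fun_prop
  have := Measure.isProbabilityMeasure_map (μ := Q) hm'.aemeasurable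
  refine isExpSymmetric_of_charFun hX.levyMeasure hb hH σ T fun q ↦ ?_
  rw [charFun_apply_real, integral_map hm'.aemeasurable (by fun_prop)]
  have e : ∀ ω, Complex.exp (q * ((X T ω - (μ - σ ^ 2 * b - H) * T : ℝ) : ℂ) * Complex.I)
      = Complex.exp (-(q * (μ - σ ^ 2 * b - H) * T * Complex.I))
        * Complex.exp (Complex.I * q * (X T ω : ℂ)) := fun ω ↦ by
    rw [← Complex.exp_add]
    congr 1
    push_cast
    ring
  simp_rw [e]
  rw [integral_const_mul, hX.charFun_eq, ← Complex.exp_add, charExponent, charExponent]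
  congr 1
  push_cast
  ring

end LevyMarket

theorem theorem4p1 {Ω : Type*} {m : MeasurableSpace Ω} (Q : Measure Ω) [IsProbabilityMeasure Q]
    (ℱ : Filtration ℝ≥0 m) (X : ℝ≥0 → Ω → ℝ) (hX : LevyMarket.IsLevyProcess ℱ Q X)
    (μ σ β : ℝ) (Pi₀ : Measure ℝ) (hsymm : LevyMarket.IsSymmetricMeasure Pi₀)
    (htriplet : LevyMarket.HasTriplet Q X μ σ (LevyMarket.expTilt β Pi₀))
    (hβ : β ≠ -1 / 2) :
    Integrable (LevyMarket.lkIntegrand (2 * β * Complex.I)) (LevyMarket.expTilt β Pi₀) ∧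
    ∃ α : ℝ,
      (α : ℂ) = (if β = 0 then (μ : ℂ) else
        -LevyMarket.charExponent μ σ (LevyMarket.expTilt β Pi₀) (2 * β * Complex.I) / (2 * β)) ∧
      ∀ (S₀ : ℝ) (T : ℝ≥0) (f : ℝ → ℝ), 0 < S₀ → Measurable f → (∀ x, 0 ≤ f x) →
        ∫⁻ ω, ENNReal.ofReal (f (LevyMarket.stock S₀ X T ω)) ∂Q =
          ∫⁻ ω, ENNReal.ofReal
            ((LevyMarket.stock S₀ X T ω / (S₀ * Real.exp (α * T))) ^ (-2 * β) *
              f (S₀ ^ 2 * Real.exp (2 * α * T) / LevyMarket.stock S₀ X T ω)) ∂Q := by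
  have hP := hsymm.isExpSymmetric_expTilt β
  have hL := htriplet.levyMeasure
  obtain ⟨H, hlim, hH, hH0⟩ := hL.exists_tendsto_integral_trunc hP
  refine ⟨hL.integrable_lkIntegrand_two_mul_I hP, μ - σ ^ 2 * β - H, ?_, ?_⟩
  · split_ifs with h0
    · simp [h0, hH0 h0]
    · have h0' : (β : ℂ) ≠ 0 := by exact_mod_cast h0
      rw [LevyMarket.charExponent, hH]
      push_cast
      field_simp
      linear_combination (μ - σ ^ 2 * β : ℂ) * Complex.I_sq
  · intro S₀ T f hS hf hf0
    set α : ℝ := μ - σ ^ 2 * β - H with hα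
    have hm : Measurable (X T) := (hX.adapted T).mono (ℱ.le T) le_rfl
    have hm' : Measurable fun ω ↦ X T ω - α * T := by fun_prop
    -- With `x = X T - αT`, this test function at `-x` is `f(S_T)` and at `x` is `f(S₀² e^{2αT} /
    -- S_T)`.
    have key := htriplet.isExpSymmetric_map hP hlim T hm
      (fun x ↦ ENNReal.ofReal (f (S₀ * Real.exp (α * T - x)))) (by fun_prop)
    rw [← hα, lintegral_map (by fun_prop) hm', lintegral_map (by fun_prop) hm'] at key
    convert key using 3 with ω ω
    · rw [LevyMarket.stock]
      ring_nf
    · rw [← ENNReal.ofReal_mul (by positivity), LevyMarket.stock]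
      have e1 : S₀ * Real.exp (X T ω) / (S₀ * Real.exp (α * T)) = Real.exp (X T ω - α * T) := by
        rw [Real.exp_sub]
        field_simp
      have e2 : S₀ ^ 2 * Real.exp (2 * α * T) / (S₀ * Real.exp (X T ω))
          = S₀ * Real.exp (α * T - (X T ω - α * T)) := by
        rw [show α * T - (X T ω - α * T) = 2 * α * T - X T ω by ring, Real.exp_sub]
        field_simp
      rw [e1, e2, ← Real.exp_mul]
      ring_nf
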